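/- **Setting.** Let $J\subset\mathbb R^2$ be a Jordan curve (the image of a circle under a continuous injective map). For $p\notin J$ let $s_p$ be the maximal open vertical segment (possibly infinite) that contains $p$ and does not meet $J$. Let $\sim$ be the equivalence relation on such open segments generated by: $s\sim s'$ if some horizontal segment disjoint from $J$ joins a point of $s$ to a point of $s'$. Fix $p^*\in\mathbb R^2\setminus J$ such that no open segment in the class $[s_{p^*}]$ has infinite length. For a horizontal segment $t$ whose interior does not meet $J$, the horizontal sweep $H(t)$ is the union of the segments $s_p$, $p\in t\setminus J$. For a finite or infinite sequence of sweeps, the swept region $E$ is the union of the sweeps, and $K=\partial E$ is its boundary. Write $\mathcal V(K)$ for the set of vertical segments of $K$, i.e. open vertical segments that are contained in $K$, do not meet $J$ and have both endpoints on $J$. $K$ is a piecewise-vertical Jordan curve if it is a Jordan curve contained in the union of $J$ and the segments in $\mathcal V(K)$. For a closed set $K$, $\mathrm{ext}(K)$ denotes the set of points that lie in unbounded connected components of $\mathbb R^2\setminus K$. A sweepline algorithm started at $p^*$ is a non-empty finite or infinite sequence $(H(t_1),H(t_2),\dots)$ of sweeps such that $p^*\in\mathrm{int}(t_1)$ and,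 for each $i\ge 1$ for which $t_{i+1}$ is present, $t_{i+1}$ has one endpoint $m$ on some segment of $\mathcal V(K_i)$ and $t_{i+1}\setminus\{m\}\subset\mathrm{ext}(K_i)$, where $K_i$ is the boundary of the region swept by $H(t_1),\dots,H(t_i)$. It is maximal if its swept region is maximal under inclusion among the regions swept by sweepline algorithms started at $p^*$, and the boundary of its swept region is a piecewise-vertical Jordan curve that has no vertical segments. The greedy algorithm $\mathcal S_{greedy}$ takes for $t_1$ the horizontal segment with $p^*\in\mathrm{int}(t_1)$, $\mathrm{int}(t_1)\cap J=\emptyset$ and both endpoints on $J$. For $i=1,2,\dots$ it halts if $\mathcal V(K_i)=\emptyset$; otherwise it picks a segment $u_i\in\mathcal V(K_i)$ of maximum length, with midpoint $m_i$, and takes for $t_{i+1}$ a horizontal segment with one endpoint $m_i$, the other endpoint on $J$, $\mathrm{int}(t_{i+1})\cap J=\emptyset$ and $t_{i+1}\setminus\{m_i\}\subset\mathrm{ext}(K_i)$. **Theorem.** $\mathcal S_{greedy}$ is a maximal sweepline algorithm: for every execution of $\mathcal S_{greedy}$ (one that halts, or one that runs forever), with whatever choice among longest segments, the sequence of its sweeps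 is a sweepline algorithm started at $p^*$ whose swept region $E_{greedy}$ is maximal under inclusion among the regions swept by sweepline algorithms started at $p^*$, and $K_{greedy}=\partial E_{greedy}$ is a piecewise-vertical Jordan curve with $\mathcal V(K_{greedy})=\emptyset$. -/

import Mathlib

namespace Sweepline

/-- A Jordan curve: the image of the circle under a continuous injective map into the plane. -/
def IsJordanCurve (J : Set (ℝ × ℝ)) : Prop :=
  ∃ γ : Circle → ℝ × ℝ, Continuous γ ∧ Function.Injective γ ∧ Set.range γ = J

/-- `ext(K)`: the points off `K` whose connected component in the complement of `K` is
unbounded. -/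
def exterior (K : Set (ℝ × ℝ)) : Set (ℝ × ℝ) :=
  {p | p ∉ K ∧ ¬ Bornology.IsBounded (connectedComponentIn Kᶜ p)}

/-- `s_p`: the maximal open vertical segment through `p` that does not meet `J`
(it is empty when `p ∈ J`). -/
def openSeg (J : Set (ℝ × ℝ)) (p : ℝ × ℝ) : Set (ℝ × ℝ) :=
  {q | q.1 = p.1 ∧ Disjoint (segment ℝ p q) J}

/-- Two open vertical segments are adjacent if a horizontal segment that does not meet `J`
joins a point of one to a point of the other. -/
def HorizAdj (J s s' : Set (ℝ × ℝ)) : Prop :=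
  ∃ a b : ℝ × ℝ, a.2 = b.2 ∧ Disjoint (segment ℝ a b) J ∧ s = openSeg J a ∧ s' = openSeg J b

/-- The equivalence relation on open vertical segments generated by adjacency. -/
def SegEquiv (J : Set (ℝ × ℝ)) : Set (ℝ × ℝ) → Set (ℝ × ℝ) → Prop :=
  Relation.EqvGen (HorizAdj J)

/-- A nondegenerate horizontal segment. -/
structure HSeg where
  y : ℝ
  l : ℝ
  r : ℝ
  lt : l < r

namespace HSeg

def left (t : HSeg) : ℝ × ℝ := (t.l, t.y)

def right (t : HSeg) : ℝ × ℝ := (t.r, t.y)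

/-- The closed segment. -/
def carrier (t : HSeg) : Set (ℝ × ℝ) := Set.Icc t.l t.r ×ˢ {t.y}

/-- The segment without its endpoints. -/
def int (t : HSeg) : Set (ℝ × ℝ) := Set.Ioo t.l t.r ×ˢ {t.y}

end HSeg

/-- A nondegenerate vertical segment. -/
structure VSeg where
  x : ℝ
  lo : ℝ
  hi : ℝ
  lt : lo < hi

namespace VSeg

/-- The open segment. -/
def carrier (u : VSeg) : Set (ℝ × ℝ) := {u.x} ×ˢ Set.Ioo u.lo u.hi

def length (u : VSeg) : ℝ := u.hi - u.lo

noncomputable def midpoint (u : VSeg) : ℝ × ℝ := (u.x, (u.lo + u.hi) / 2)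

end VSeg

/-- `𝒱(K)`: the vertical segments of a curve `K` made of parts of `J` and of vertical segments.
They are the open vertical segments that lie in `K`, do not meet `J`, and have both endpoints
on `J`. -/
def verticalSegments (J K : Set (ℝ × ℝ)) : Set VSeg :=
  {u | u.carrier ⊆ K ∧ Disjoint u.carrier J ∧ (u.x, u.lo) ∈ J ∧ (u.x, u.hi) ∈ J}

/-- A piecewise-vertical Jordan curve (with respect to `J`): a Jordan curve all of whose points
lie on `J` or on one of its vertical segments. -/
def IsPiecewiseVertical (J K : Set (ℝ × ℝ)) : Prop :=
  IsJordanCurve K ∧ K ⊆ J ∪ ⋃ u ∈ verticalSegments J K, u.carrier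

/-- The region covered by the horizontal sweep `H(t)`: the union of the open segments `s_p`
over the points `p` of `t` that are not on `J`. -/
def sweep (J : Set (ℝ × ℝ)) (t : HSeg) : Set (ℝ × ℝ) :=
  ⋃ p ∈ t.carrier \ J, openSeg J p

/-- The region swept by the first `N ≤ ∞` sweeps `H(t 0), H(t 1), …`. -/
def swept (J : Set (ℝ × ℝ)) (t : ℕ → HSeg) (N : ℕ∞) : Set (ℝ × ℝ) :=
  ⋃ (i : ℕ) (_ : (i : ℕ∞) < N), sweep J (t i)

/-- The curve bounding the region swept by the first `N ≤ ∞` sweeps. -/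
def boundary (J : Set (ℝ × ℝ)) (t : ℕ → HSeg) (N : ℕ∞) : Set (ℝ × ℝ) :=
  frontier (swept J t N)

/-- `(H(t 0), H(t 1), …)`, with `N ≤ ∞` terms, is a sweepline algorithm started at `p`: the
interior of every `t i` avoids `J`, `p` lies in the interior of `t 0`, and every later `t (i + 1)`
has one endpoint `m` on a vertical segment of the boundary of the region swept so far, and apart
from `m` lies in the exterior of that boundary. Entries of `t` from `N` on play no role. -/
structure IsSweepline (J : Set (ℝ × ℝ)) (p : ℝ × ℝ) (t : ℕ → HSeg) (N : ℕ∞) : Prop where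
  pos : 0 < N
  start : p ∈ (t 0).int
  disj : ∀ i : ℕ, (i : ℕ∞) < N → Disjoint (t i).int J
  step : ∀ i : ℕ, ((i + 1 : ℕ) : ℕ∞) < N →
    ∃ u ∈ verticalSegments J (boundary J t (i + 1 : ℕ)), ∃ m ∈ u.carrier,
      ((t (i + 1)).left = m ∨ (t (i + 1)).right = m) ∧
      (t (i + 1)).carrier \ {m} ⊆ exterior (boundary J t (i + 1 : ℕ))

/-- An execution of the greedy sweepline algorithm started at `p`, with `N ≤ ∞` sweeps.
With `K i` the boundary of the region swept by `t 0, …, t i`, the segment `u i` is a vertical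
segment of `K i` of maximum length, and `t (i + 1)` runs from the midpoint of `u i`, in the
exterior of `K i`, to the first point of `J`. The execution is finite only if it halts because
there is no vertical segment left. -/
structure IsGreedyRun (J : Set (ℝ × ℝ)) (p : ℝ × ℝ) (t : ℕ → HSeg) (u : ℕ → VSeg) (N : ℕ∞) :
    Prop where
  pos : 0 < N
  start : p ∈ (t 0).int
  start_left : (t 0).left ∈ J
  start_right : (t 0).right ∈ J
  disj : ∀ i : ℕ, (i : ℕ∞) < N → Disjoint (t i).int J
  mem : ∀ i : ℕ, ((i + 1 : ℕ) : ℕ∞) < N →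
    u i ∈ verticalSegments J (boundary J t (i + 1 : ℕ))
  longest : ∀ i : ℕ, ((i + 1 : ℕ) : ℕ∞) < N →
    ∀ v ∈ verticalSegments J (boundary J t (i + 1 : ℕ)), v.length ≤ (u i).length
  endpoints : ∀ i : ℕ, ((i + 1 : ℕ) : ℕ∞) < N →
    ((t (i + 1)).left = (u i).midpoint ∧ (t (i + 1)).right ∈ J) ∨
    ((t (i + 1)).right = (u i).midpoint ∧ (t (i + 1)).left ∈ J)
  outside : ∀ i : ℕ, ((i + 1 : ℕ) : ℕ∞) < N →
    (t (i + 1)).carrier \ {(u i).midpoint} ⊆ exterior (boundary J t (i + 1 : ℕ))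
  halt : ∀ n : ℕ, N = n → verticalSegments J (boundary J t n) = ∅

/-- The regions swept by the sweepline algorithms started at `p`. -/
def IsSweptRegion (J : Set (ℝ × ℝ)) (p : ℝ × ℝ) (E : Set (ℝ × ℝ)) : Prop :=
  ∃ (t : ℕ → HSeg) (N : ℕ∞), IsSweepline J p t N ∧ E = swept J t N

/-- A maximal sweepline algorithm: a sweepline algorithm that no other one started at the same
point can outdo (its swept region is maximal under inclusion), and whose boundary is a
piecewise-vertical Jordan curve without vertical segments. -/
structure IsMaximalSweepline (J : Set (ℝ × ℝ)) (p : ℝ × ℝ) (t : ℕ → HSeg) (N : ℕ∞) : Prop where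
  isSweepline : IsSweepline J p t N
  maximal : Maximal (IsSweptRegion J p) (swept J t N)
  piecewiseVertical : IsPiecewiseVertical J (boundary J t N)
  noVertical : verticalSegments J (boundary J t N) = ∅

end Sweepline

namespace Sweepline

open Set Filter Topology

/-! Let U be the component of p in the complement of J. It is bounded, because all vertical segments
in it belong to the class of s_p (`segEquiv_of_mem_component`). No sweepline algorithm leaves U
(`IsSweepline.swept_subset`), so it suffices that the greedy region E fills U and that its boundary
is all of J. Both follow from ∂E ⊆ J (`IsGreedyRun.frontier_subset`): the connected set U meets E
but not ∂E, so E = U; and a bounded set off J whose boundary lies in J has boundary J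
(`IsJordanCurve.subset_frontier`, a no-retraction argument).

A boundary point off J lies on a vertical segment of ∂E, which settles halting runs. In an infinite
run, a boundary point at distance c from J would keep the chosen segments at length at least 2c
forever. Their midpoints would accumulate. Since J is parametrized continuously, it cannot pass
between the middle parts of infinitely many of them (`IsJordanCurve.exists_gap`), and two segments
not separated by J, explored in the same direction, contradict the greedy rules
(`IsGreedyRun.not_gap`). -/

/-! ### Plane topology: winding numbers and boundaries inside a Jordan curve -/

/-- A nonvanishing continuous function on the plane has a continuous logarithm. -/
theorem exists_continuous_log (h : C(ℝ × ℝ, ℂ)) (h0 : ∀ z, h z ≠ 0) :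
    ∃ L : C(ℝ × ℝ, ℂ), ∀ z, Complex.exp (L z) = h z := by
  let f : C(ℝ × ℝ, {z : ℂ // z ≠ 0}) := ⟨fun z => ⟨h z, h0 z⟩, by fun_prop⟩
  obtain ⟨L, ⟨-, hL⟩, -⟩ := Complex.isCoveringMap_exp.existsUnique_continuousMap_lifts f 0
    (Complex.log (h 0)) (Subtype.ext (Complex.exp_log (h0 0)))
  exact ⟨L, fun z => congrArg Subtype.val (congrFun hL z)⟩

/-- A continuous self-map of the plane that is the identity far away takes every value. -/
theorem mem_range_of_eq_self_off_bounded {f : ℝ × ℝ → ℝ × ℝ} (hf : Continuous f) {B : Set (ℝ × ℝ)}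
    (hB : Bornology.IsBounded B) (hfB : ∀ z ∉ B, f z = z) (p : ℝ × ℝ) : p ∈ range f := by
  by_contra hp
  let e : (ℝ × ℝ) ≃L[ℝ] ℂ := Complex.equivRealProdCLM.symm
  let h : C(ℝ × ℝ, ℂ) := ⟨fun z => e (f z - p), by fun_prop⟩
  obtain ⟨L, hL⟩ := exists_continuous_log h fun z hz =>
    hp ⟨z, sub_eq_zero.1 (e.map_eq_zero_iff.1 hz)⟩
  have hB' : Bornology.IsBounded (e '' B) := e.lipschitz.isBounded_image hB
  obtain ⟨r, hr⟩ := hB'.subset_closedBall (e p)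
  obtain ⟨R, hR0, hrR⟩ : ∃ R : ℝ, 0 < R ∧ r < R := ⟨|r| + 1, by positivity, by
    have := le_abs_self r; linarith⟩
  have hcirc : ∀ θ : ℝ, Complex.exp (L (e.symm (e p + R * Complex.exp (θ * Complex.I)))) =
      R * Complex.exp (θ * Complex.I) := by
    intro θ
    rw [hL]
    change e (f _ - p) = _
    rw [hfB]
    · simp
    · intro hmem
      have := hr (mem_image_of_mem e hmem)
      simp [Complex.norm_exp_ofReal_mul_I, abs_of_pos hR0] at this
      linarith
  -- `k` compares two logarithms along a large circle. Its exponential is the constant R, so `k` is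
  -- constant; but after a full turn `L` returns to its value while θi has grown by 2πi.
  let k : ℝ → ℂ := fun θ => L (e.symm (e p + R * Complex.exp (θ * Complex.I))) - θ * Complex.I
  have hk : Continuous k := by fun_prop
  have hkexp : ∀ θ, Complex.exp (k θ) = R := by
    intro θ
    rw [Complex.exp_sub, hcirc, mul_div_assoc, div_self (Complex.exp_ne_zero _), mul_one]
  have hconst : k 0 = k (2 * Real.pi) := by
    have hcov := Complex.isCoveringMap_exp
    refine hcov.const_of_comp hk (fun a b => Subtype.ext ?_) _ _
    simp only [hkexp]
  have h2 : Complex.exp (((2 * Real.pi : ℝ) : ℂ) * Complex.I) = Complex.exp ((0 : ℝ) * Complex.I) := by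
    push_cast; simp [Complex.exp_two_pi_mul_I]
  simp only [k, h2] at hconst
  have h3 : ((2 * Real.pi : ℝ) : ℂ) * Complex.I = 0 := by
    have : ∀ a b : ℂ, a - ((0 : ℝ) : ℂ) * Complex.I = a - b → b = 0 := by
      intro a b h; simpa using h.symm
    exact this _ _ hconst
  simp at h3

theorem IsJordanCurve.isCompact {J : Set (ℝ × ℝ)} (hJ : IsJordanCurve J) : IsCompact J := by
  obtain ⟨γ, hγ, -, rfl⟩ := hJ
  exact isCompact_range hγ

/-- The boundary of a bounded set that lies off `J` and has its boundary on the Jordan curve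
`J` is all of `J`. -/
theorem IsJordanCurve.subset_frontier {J U : Set (ℝ × ℝ)} (hJ : IsJordanCurve J)
    (hUJ : Disjoint U J) (hUb : Bornology.IsBounded U) (hUne : U.Nonempty)
    (hfr : frontier U ⊆ J) : J ⊆ frontier U := by
  classical
  obtain ⟨γ, hγ, hinj, rfl⟩ := hJ
  rintro _ ⟨w, rfl⟩
  by_contra hw
  have hemb := hγ.isClosedEmbedding hinj
  let E : Circle ≃ₜ range γ := hemb.isEmbedding.toHomeomorph
  -- The minus sign puts the branch cut of `arg` at the parameter `w`, which the boundary of `U`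
  -- avoids; hence the angle is continuous there.
  let φ : C(frontier U, ℝ) :=
    ⟨fun z => Complex.arg (-((E.symm ⟨z, hfr z.2⟩ : Circle) : ℂ) / (w : ℂ)), by
      have hc : Continuous fun z : frontier U => -((E.symm ⟨z, hfr z.2⟩ : Circle) : ℂ) / (w : ℂ) := by
        refine Continuous.div_const (Continuous.neg ?_) _
        exact continuous_subtype_val.comp (E.symm.continuous.comp (by fun_prop))
      refine continuous_iff_continuousAt.2 fun z =>
        (Complex.continuousAt_arg ?_).comp (f := fun z : frontier U =>
          -((E.symm ⟨z, hfr z.2⟩ : Circle) : ℂ) / (w : ℂ)) hc.continuousAt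
      rw [Complex.mem_slitPlane_iff_not_le_zero]
      intro hle
      have hnorm : ‖-((E.symm ⟨z, hfr z.2⟩ : Circle) : ℂ) / (w : ℂ)‖ = 1 := by
        rw [norm_div, norm_neg, Circle.norm_coe, Circle.norm_coe, div_one]
      rw [Complex.le_def] at hle
      have hre : -((E.symm ⟨z, hfr z.2⟩ : Circle) : ℂ) / (w : ℂ) = -1 := by
        set a := -((E.symm ⟨z, hfr z.2⟩ : Circle) : ℂ) / (w : ℂ)
        have him : a.im = 0 := hle.2
        have hre : a.re ≤ 0 := hle.1
        have : ((a.re : ℝ) : ℂ) = a := Complex.ext (by simp) (by simp [him])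
        rw [← this, Complex.norm_real, Real.norm_eq_abs, abs_of_nonpos hre] at hnorm
        rw [← this, show a.re = -1 by linarith]; simp
      have hEw : E.symm ⟨z, hfr z.2⟩ = w := by
        rw [neg_div, neg_inj, div_eq_one_iff_eq (Circle.coe_ne_zero w)] at hre
        exact Circle.ext hre
      have : (⟨z, hfr z.2⟩ : range γ) = E w := by rw [← hEw]; simp
      have : (z : ℝ × ℝ) = γ w := congrArg Subtype.val this
      exact hw (this ▸ z.2)⟩
  -- Tietze extension of the angle yields a map `r` from the plane into J that fixes the boundary of
  -- `U`; the added π in `r` undoes the minus sign.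
  obtain ⟨Φ, hΦ⟩ := φ.exists_restrict_eq isClosed_frontier
  let r : ℝ × ℝ → ℝ × ℝ := fun z => γ (Circle.exp (Φ z + Real.pi) * w)
  have hr : Continuous r := by fun_prop
  have hrid : ∀ z ∈ frontier U, r z = z := by
    intro z hz
    have h1 : Φ z = φ ⟨z, hz⟩ := DFunLike.congr_fun hΦ ⟨z, hz⟩
    have h2 : γ (E.symm ⟨z, hfr hz⟩) = z := congrArg Subtype.val (E.apply_symm_apply ⟨z, hfr hz⟩)
    change γ _ = z
    rw [← h2]
    congr 1
    apply Circle.ext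
    rw [h2, h1]
    have h3 := Complex.norm_mul_exp_arg_mul_I (-((E.symm ⟨z, hfr hz⟩ : Circle) : ℂ) / (w : ℂ))
    simp only [norm_div, norm_neg, Circle.norm_coe, div_one, Complex.ofReal_one, one_mul] at h3
    rw [Circle.coe_mul, Circle.coe_exp]
    push_cast
    rw [add_mul, Complex.exp_add, Complex.exp_pi_mul_I]
    simp only [φ, ContinuousMap.coe_mk]
    rw [h3]
    field_simp [Circle.coe_ne_zero w]
  -- This map is the identity off a bounded set, yet it misses every point of `U`: on the closure of
  -- `U` its values lie in J, elsewhere it moves nothing.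
  let f : ℝ × ℝ → ℝ × ℝ := (closure U).piecewise r id
  have hf : Continuous f := by
    refine Continuous.piecewise (fun z hz => hrid z ?_) hr continuous_id
    exact frontier_closure_subset hz
  obtain ⟨p, hp⟩ := hUne
  obtain ⟨z, hz⟩ := mem_range_of_eq_self_off_bounded hf hUb.closure
    (fun z hz => piecewise_eq_of_notMem _ _ _ hz) p
  by_cases hzU : z ∈ closure U
  · rw [show f z = r z from piecewise_eq_of_mem _ _ _ hzU] at hz
    exact hUJ.le_bot ⟨hp, hz ▸ mem_range_self _⟩
  · rw [show f z = z from piecewise_eq_of_notMem _ _ _ hzU] at hz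
    exact hzU (hz ▸ subset_closure hp)

/-! ### Maximal open vertical segments -/

theorem mem_openSeg_iff {J : Set (ℝ × ℝ)} {p q : ℝ × ℝ} :
    q ∈ openSeg J p ↔ q.1 = p.1 ∧ ∀ y ∈ uIcc p.2 q.2, (p.1, y) ∉ J := by
  obtain ⟨a, b⟩ := p
  obtain ⟨a', b'⟩ := q
  simp only [openSeg, mem_ofPred_eq]
  refine and_congr_right fun h => ?_
  subst h
  rw [← Prod.image_mk_segment_right, segment_eq_uIcc, disjoint_left, forall_mem_image]

theorem mem_openSeg_self {J : Set (ℝ × ℝ)} {p : ℝ × ℝ} (hp : p ∉ J) : p ∈ openSeg J p := by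
  simp [mem_openSeg_iff, hp]

theorem mem_openSeg_symm {J : Set (ℝ × ℝ)} {p q : ℝ × ℝ} (h : q ∈ openSeg J p) :
    p ∈ openSeg J q := by
  rw [mem_openSeg_iff] at h ⊢
  rw [uIcc_comm, h.1]
  exact ⟨rfl, h.2⟩

theorem mem_openSeg_trans {J : Set (ℝ × ℝ)} {p q r : ℝ × ℝ} (h : q ∈ openSeg J p)
    (h' : r ∈ openSeg J q) : r ∈ openSeg J p := by
  rw [mem_openSeg_iff] at h h' ⊢
  refine ⟨h'.1.trans h.1, fun y hy => ?_⟩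
  rcases uIcc_subset_uIcc_union_uIcc (b := q.2) hy with hy | hy
  · exact h.2 y hy
  · exact h.1 ▸ h'.2 y hy

theorem openSeg_eq_of_mem {J : Set (ℝ × ℝ)} {p q : ℝ × ℝ} (h : q ∈ openSeg J p) :
    openSeg J q = openSeg J p :=
  Subset.antisymm (fun _ hr => mem_openSeg_trans h hr)
    fun _ hr => mem_openSeg_trans (mem_openSeg_symm h) hr

theorem notMem_of_mem_openSeg {J : Set (ℝ × ℝ)} {p q : ℝ × ℝ} (h : q ∈ openSeg J p) : q ∉ J := by
  rw [mem_openSeg_iff] at h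
  have := h.2 q.2 right_mem_uIcc
  rwa [← h.1] at this

theorem mem_openSeg_of_segment_subset {J B : Set (ℝ × ℝ)} {p q : ℝ × ℝ} (hB : Convex ℝ B)
    (hBJ : Disjoint B J) (hp : p ∈ B) (hq : q ∈ B) (h : q.1 = p.1) : q ∈ openSeg J p :=
  ⟨h, hBJ.mono_left (hB.segment_subset hp hq)⟩

theorem mem_component_of_mem_openSeg {J : Set (ℝ × ℝ)} {p q : ℝ × ℝ} (h : q ∈ openSeg J p) :
    q ∈ connectedComponentIn Jᶜ p :=
  (convex_segment p q).isPreconnected.subset_connectedComponentIn (left_mem_segment ℝ p q)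
    (disjoint_left.1 h.2) (right_mem_segment ℝ p q)

theorem exists_ball_disjoint {J : Set (ℝ × ℝ)} (hJ : IsClosed J) {p : ℝ × ℝ} (hp : p ∉ J) :
    ∃ δ > 0, Disjoint (Metric.ball p δ) J := by
  obtain ⟨δ, hδ, h⟩ := Metric.isOpen_iff.1 hJ.isOpen_compl p hp
  exact ⟨δ, hδ, disjoint_left.2 h⟩

/-- Small translates of a vertical segment off `J` stay off `J`. -/
theorem eventually_add_mem_openSeg {J : Set (ℝ × ℝ)} (hJ : IsClosed J) {p q : ℝ × ℝ}
    (h : q ∈ openSeg J p) : ∀ᶠ v in 𝓝 (0 : ℝ × ℝ), q + v ∈ openSeg J (p + v) := by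
  have hc : IsCompact (segment ℝ p q) := by
    rw [segment_eq_image_lineMap]
    exact isCompact_Icc.image AffineMap.lineMap_continuous
  obtain ⟨δ, hδ, hsub⟩ := hc.exists_thickening_subset_open hJ.isOpen_compl (disjoint_left.1 h.2)
  filter_upwards [Metric.ball_mem_nhds (0 : ℝ × ℝ) hδ] with v hv
  refine ⟨by simp [h.1], disjoint_left.2 fun z hz => hsub ?_⟩
  rw [add_comm p, add_comm q, ← segment_translate_image] at hz
  obtain ⟨w, hw, rfl⟩ := hz
  rw [Metric.mem_thickening_iff]
  exact ⟨w, hw, by simpa [dist_eq_norm] using hv⟩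

/-- Near a point of `s_p`, vertical segments off `J` reach to the height of `p`. -/
theorem eventually_mem_openSeg_mk {J : Set (ℝ × ℝ)} (hJ : IsClosed J) {p q : ℝ × ℝ}
    (h : q ∈ openSeg J p) : ∀ᶠ x in 𝓝 q, x ∈ openSeg J (x.1, p.2) := by
  obtain ⟨δ, hδ, hball⟩ := exists_ball_disjoint hJ (notMem_of_mem_openSeg h)
  have ht : Tendsto (fun x : ℝ × ℝ => (x.1 - q.1, (0 : ℝ))) (𝓝 q) (𝓝 0) := by
    have : Continuous fun x : ℝ × ℝ => (x.1 - q.1, (0 : ℝ)) := by fun_prop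
    simpa [Prod.zero_eq_mk] using this.tendsto q
  filter_upwards [ht.eventually (eventually_add_mem_openSeg hJ h), Metric.ball_mem_nhds q hδ]
    with x hx hxb
  have h1 : q + (x.1 - q.1, (0 : ℝ)) = (x.1, q.2) := by ext <;> simp
  have h2 : p + (x.1 - q.1, (0 : ℝ)) = (x.1, p.2) := by ext <;> simp [h.1]
  rw [h1, h2] at hx
  -- Balls of the sup metric are squares, so the remaining vertical move from (x.1, q.2) to x stays
  -- in the ball.
  refine mem_openSeg_trans hx (mem_openSeg_of_segment_subset (convex_ball q δ) hball ?_ hxb rfl)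
  rw [Metric.mem_ball, Prod.dist_eq] at hxb ⊢
  simpa [hδ] using lt_of_le_of_lt (le_max_left _ _) hxb

/-- A bounded `s_p` is an open vertical segment with both endpoints on `J`. -/
theorem exists_vseg_carrier_eq {J : Set (ℝ × ℝ)} (hJ : IsClosed J) {p : ℝ × ℝ} (hp : p ∉ J)
    (hb : Bornology.IsBounded (openSeg J p)) :
    ∃ v : VSeg, v.carrier = openSeg J p ∧ (v.x, v.lo) ∈ J ∧ (v.x, v.hi) ∈ J := by
  obtain ⟨R, hR⟩ := hb.subset_closedBall 0
  have hR' : ∀ y, (p.1, y) ∈ openSeg J p → |y| ≤ R := by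
    intro y hy
    have := hR hy
    rw [mem_closedBall_zero_iff, Prod.norm_def] at this
    exact (le_max_right _ _).trans this
  have hcl : IsClosed {y : ℝ | (p.1, y) ∈ J} := hJ.preimage (by fun_prop)
  have hup : ({y : ℝ | (p.1, y) ∈ J} ∩ Ici p.2).Nonempty := by
    by_contra hne
    rw [not_nonempty_iff_eq_empty] at hne
    have hle : p.2 ≤ max p.2 (R + 1) := le_max_left _ _
    have := hR' (max p.2 (R + 1)) (mem_openSeg_iff.2 ⟨rfl, fun y hy hyJ => by
      rw [uIcc_of_le hle] at hy
      exact (hne ▸ ⟨hyJ, hy.1⟩ : y ∈ (∅ : Set ℝ))⟩)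
    have := (le_max_right p.2 (R + 1)).trans ((le_abs_self _).trans this)
    linarith
  have hlow : ({y : ℝ | (p.1, y) ∈ J} ∩ Iic p.2).Nonempty := by
    by_contra hne
    rw [not_nonempty_iff_eq_empty] at hne
    have hle : min p.2 (-R - 1) ≤ p.2 := min_le_left _ _
    have := hR' (min p.2 (-R - 1)) (mem_openSeg_iff.2 ⟨rfl, fun y hy hyJ => by
      rw [uIcc_of_ge hle] at hy
      exact (hne ▸ ⟨hyJ, hy.2⟩ : y ∈ (∅ : Set ℝ))⟩)
    have h1 := (neg_abs_le _).trans (min_le_right p.2 (-R - 1))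
    linarith
  have hbdd : BddBelow ({y : ℝ | (p.1, y) ∈ J} ∩ Ici p.2) := bddBelow_Ici.mono inter_subset_right
  have hbdd' : BddAbove ({y : ℝ | (p.1, y) ∈ J} ∩ Iic p.2) := bddAbove_Iic.mono inter_subset_right
  have hhi := (hcl.inter isClosed_Ici).csInf_mem hup hbdd
  have hlo := (hcl.inter isClosed_Iic).csSup_mem hlow hbdd'
  have hminhi := fun y hy => csInf_le hbdd (a := y) hy
  have hmaxlo := fun y hy => le_csSup hbdd' (a := y) hy
  set hi := sInf ({y : ℝ | (p.1, y) ∈ J} ∩ Ici p.2)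
  set lo := sSup ({y : ℝ | (p.1, y) ∈ J} ∩ Iic p.2)
  have hhi' : p.2 < hi := lt_of_le_of_ne hhi.2 fun h => hp (by have := hhi.1; rwa [← h] at this)
  have hlo' : lo < p.2 := lt_of_le_of_ne hlo.2 fun h => hp (by have := hlo.1; rwa [h] at this)
  refine ⟨⟨p.1, lo, hi, hlo'.trans hhi'⟩, ?_, hlo.1, hhi.1⟩
  ext ⟨a, b⟩
  simp only [VSeg.carrier, mem_prod, mem_singleton_iff, mem_Ioo, mem_openSeg_iff]
  refine and_congr_right fun _ => ⟨fun hb y hy hyJ => ?_, fun h => ⟨?_, ?_⟩⟩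
  · rcases le_total p.2 y with hpy | hpy
    · have h1 := hminhi y ⟨hyJ, hpy⟩
      have h2 : y ≤ max p.2 b := hy.2
      rcases le_max_iff.1 h2 with h2 | h2 <;> linarith [hb.2]
    · have h1 := hmaxlo y ⟨hyJ, hpy⟩
      have h2 : min p.2 b ≤ y := hy.1
      rcases min_le_iff.1 h2 with h2 | h2 <;> linarith [hb.1]
  · by_contra hle
    exact h lo (mem_uIcc.2 (Or.inr ⟨not_lt.1 hle, hlo'.le⟩)) hlo.1
  · by_contra hle
    exact h hi (mem_uIcc.2 (Or.inl ⟨hhi'.le, not_lt.1 hle⟩)) hhi.1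

theorem openSeg_eq_carrier {J : Set (ℝ × ℝ)} {v : VSeg} (hd : Disjoint v.carrier J)
    (hlo : (v.x, v.lo) ∈ J) (hhi : (v.x, v.hi) ∈ J) {m : ℝ × ℝ} (hm : m ∈ v.carrier) :
    openSeg J m = v.carrier := by
  obtain ⟨a, b⟩ := m
  simp only [VSeg.carrier, mem_prod, mem_singleton_iff, mem_Ioo] at hm
  obtain ⟨rfl, hb⟩ := hm
  ext ⟨a, b'⟩
  simp only [VSeg.carrier, mem_prod, mem_singleton_iff, mem_Ioo, mem_openSeg_iff]
  refine and_congr_right fun _ => ⟨fun h => ⟨?_, ?_⟩, fun h y hy hyJ => ?_⟩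
  · by_contra hle
    exact h v.lo (mem_uIcc.2 (Or.inr ⟨not_lt.1 hle, hb.1.le⟩)) hlo
  · by_contra hle
    exact h v.hi (mem_uIcc.2 (Or.inl ⟨hb.2.le, not_lt.1 hle⟩)) hhi
  · have hyv : (v.x, y) ∈ v.carrier := ⟨rfl, ordConnected_Ioo.uIcc_subset hb h hy⟩
    exact disjoint_left.1 hd hyv hyJ

/-! ### Saturated sets -/

/-- A set is saturated if it contains `s_p` for each of its points `p`. -/
def Saturated (J E : Set (ℝ × ℝ)) : Prop := ∀ p ∈ E, openSeg J p ⊆ E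

theorem Saturated.compl {J E : Set (ℝ × ℝ)} (h : Saturated J E) : Saturated J Eᶜ :=
  fun _ hp _ hq hqE => hp (h _ hqE (mem_openSeg_symm hq))

/-- The vertical segment from p to q, translated by x - p for x in E close to p, still avoids J; so
points of E near p yield points of E near q. -/
theorem Saturated.closure {J E : Set (ℝ × ℝ)} (hJ : IsClosed J) (h : Saturated J E) :
    Saturated J (closure E) := by
  intro p hp q hq
  have ht : Tendsto (fun x : ℝ × ℝ => x - p) (𝓝 p) (𝓝 0) := by
    have : Continuous fun x : ℝ × ℝ => x - p := by fun_prop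
    simpa using this.tendsto p
  have ht' : Tendsto (fun x : ℝ × ℝ => q + (x - p)) (𝓝 p) (𝓝 q) := by
    have : Continuous fun x : ℝ × ℝ => q + (x - p) := by fun_prop
    simpa using this.tendsto p
  rw [mem_closure_iff_frequently] at hp ⊢
  refine ht'.frequently ((hp.and_eventually (ht.eventually
    (eventually_add_mem_openSeg hJ hq))).mono fun x hx => ?_)
  have := hx.2
  rw [add_sub_cancel] at this
  exact h x hx.1 this

theorem Saturated.frontier {J E : Set (ℝ × ℝ)} (hJ : IsClosed J) (h : Saturated J E) :
    Saturated J (frontier E) := by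
  intro p hp q hq
  rw [frontier_eq_closure_inter_closure] at hp ⊢
  exact ⟨h.closure hJ p hp.1 hq, h.compl.closure hJ p hp.2 hq⟩

/-- A preconnected set that meets `E` but not its boundary lies inside `E`. -/
theorem subset_interior_of_disjoint_frontier {X : Type*} [TopologicalSpace X] {C E : Set X}
    (hC : IsPreconnected C) (hd : Disjoint C (frontier E)) (hne : (C ∩ E).Nonempty) :
    C ⊆ interior E := by
  have hcov : ∀ x ∈ C, x ∈ closure E → x ∈ interior E := fun x hx hxE => by
    by_contra hxi
    exact disjoint_left.1 hd hx ⟨hxE, hxi⟩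
  refine hC.subset_left_of_subset_union isOpen_interior isClosed_closure.isOpen_compl
    (disjoint_compl_right_iff_subset.2 (interior_subset.trans subset_closure)) (fun x hx => ?_) ?_
  · by_cases hxE : x ∈ closure E
    · exact Or.inl (hcov x hx hxE)
    · exact Or.inr hxE
  · obtain ⟨x, hx, hxE⟩ := hne
    exact ⟨x, hx, hcov x hx (subset_closure hxE)⟩

/-- The component of a point of E off the boundary of E cannot leave E, hence is bounded. -/
theorem disjoint_exterior_frontier {E : Set (ℝ × ℝ)} (hE : Bornology.IsBounded E) :
    Disjoint E (exterior (frontier E)) := by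
  refine disjoint_left.2 fun x hx hxe => hxe.2 (hE.subset ?_)
  refine (subset_interior_of_disjoint_frontier isPreconnected_connectedComponentIn
    (disjoint_left.2 (connectedComponentIn_subset _ x)) ⟨x, ?_, hx⟩).trans interior_subset
  exact mem_connectedComponentIn hxe.1

/-! ### Sweeps -/

theorem saturated_sweep (J : Set (ℝ × ℝ)) (t : HSeg) : Saturated J (sweep J t) := by
  intro p hp q hq
  simp only [sweep, mem_iUnion] at hp ⊢
  obtain ⟨a, ha, hpa⟩ := hp
  exact ⟨a, ha, mem_openSeg_trans hpa hq⟩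

theorem saturated_swept (J : Set (ℝ × ℝ)) (t : ℕ → HSeg) (N : ℕ∞) :
    Saturated J (swept J t N) := by
  intro p hp q hq
  simp only [swept, mem_iUnion] at hp ⊢
  obtain ⟨i, hi, hp⟩ := hp
  exact ⟨i, hi, saturated_sweep J _ p hp hq⟩

theorem sweep_subset_swept {J : Set (ℝ × ℝ)} {t : ℕ → HSeg} {N : ℕ∞} {i : ℕ} (h : (i : ℕ∞) < N) :
    sweep J (t i) ⊆ swept J t N :=
  subset_iUnion₂_of_subset i h subset_rfl

theorem HSeg.int_subset_carrier (t : HSeg) : t.int ⊆ t.carrier :=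
  prod_mono Ioo_subset_Icc_self subset_rfl

theorem HSeg.carrier_subset_closure_int (t : HSeg) : t.carrier ⊆ closure t.int := by
  rw [HSeg.int, closure_prod_eq, closure_Ioo t.lt.ne]
  exact prod_mono subset_rfl subset_closure

theorem HSeg.isPreconnected_int (t : HSeg) : IsPreconnected t.int :=
  isPreconnected_Ioo.prod isPreconnected_singleton

theorem openSeg_subset_sweep {J : Set (ℝ × ℝ)} {t : HSeg} {p : ℝ × ℝ} (hp : p ∈ t.carrier) :
    openSeg J p ⊆ sweep J t := by
  intro q hq
  simp only [sweep, mem_iUnion]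
  exact ⟨p, ⟨hp, notMem_of_mem_openSeg (mem_openSeg_symm hq)⟩, hq⟩

/-- Neighbours of a point of s_p can be joined vertically, off J, to the height of p, where they
land on t since p is not an endpoint. -/
theorem openSeg_subset_interior_sweep {J : Set (ℝ × ℝ)} (hJ : IsClosed J) {t : HSeg} {p : ℝ × ℝ}
    (hp : p ∈ t.int) : openSeg J p ⊆ interior (sweep J t) := by
  intro q hq
  rw [mem_interior_iff_mem_nhds]
  have hqt : q.1 ∈ Ioo t.l t.r := hq.1 ▸ hp.1
  filter_upwards [eventually_mem_openSeg_mk hJ hq,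
    continuous_fst.continuousAt.eventually (Ioo_mem_nhds hqt.1 hqt.2)] with x hx hxt
  exact openSeg_subset_sweep (t.int_subset_carrier (a := (x.1, p.2)) ⟨hxt, hp.2⟩) hx

/-! ### The component of the starting point -/

/-- The class is locally constant: in a square off J, a vertical move keeps the segment and a
horizontal move passes to an adjacent one. -/
theorem segEquiv_of_mem_component {J : Set (ℝ × ℝ)} (hJ : IsClosed J) {p q : ℝ × ℝ} (hp : p ∉ J)
    (hq : q ∈ connectedComponentIn Jᶜ p) : SegEquiv J (openSeg J p) (openSeg J q) := by
  refine isPreconnected_connectedComponentIn.induction₂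
    (fun x y => SegEquiv J (openSeg J x) (openSeg J y)) (fun x hx => ?_)
    (fun _ _ _ _ _ _ h h' => .trans _ _ _ h h') (fun _ _ _ _ h => .symm _ _ h)
    (mem_connectedComponentIn hp) hq
  obtain ⟨δ, hδ, hball⟩ := exists_ball_disjoint hJ (connectedComponentIn_subset _ _ hx)
  filter_upwards [mem_nhdsWithin_of_mem_nhds (Metric.ball_mem_nhds x hδ)] with y hy
  have hz : (x.1, y.2) ∈ Metric.ball x δ := by
    rw [Metric.mem_ball, Prod.dist_eq] at hy ⊢
    simpa [hδ] using lt_of_le_of_lt (le_max_right _ _) hy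
  rw [← openSeg_eq_of_mem (mem_openSeg_of_segment_subset (convex_ball x δ) hball
    (Metric.mem_ball_self hδ) hz rfl)]
  exact .rel _ _ ⟨(x.1, y.2), y, rfl, hball.mono_left ((convex_ball x δ).segment_subset hz hy),
    rfl, rfl⟩

/-- Each vertical segment in the component is bounded with both endpoints on J, so the component
lies in any box around J. -/
theorem isBounded_component {J : Set (ℝ × ℝ)} (hJ : IsCompact J) {p : ℝ × ℝ} (hp : p ∉ J)
    (hfin : ∀ s, SegEquiv J (openSeg J p) s → Bornology.IsBounded s) :
    Bornology.IsBounded (connectedComponentIn Jᶜ p) := by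
  obtain ⟨R, hR⟩ := hJ.isBounded.subset_closedBall 0
  have hR' : ∀ z ∈ J, |z.1| ≤ R ∧ |z.2| ≤ R := by
    intro z hz
    have := hR hz
    rw [mem_closedBall_zero_iff, Prod.norm_def] at this
    exact ⟨(le_max_left _ _).trans this, (le_max_right _ _).trans this⟩
  refine Metric.isBounded_closedBall (x := (0 : ℝ × ℝ)) (r := R) |>.subset fun q hq => ?_
  have hqJ : q ∉ J := connectedComponentIn_subset _ _ hq
  obtain ⟨v, hv, hlo, hhi⟩ := exists_vseg_carrier_eq hJ.isClosed hqJ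
    (hfin _ (segEquiv_of_mem_component hJ.isClosed hp hq))
  have hqv : q ∈ v.carrier := hv ▸ mem_openSeg_self hqJ
  simp only [VSeg.carrier, mem_prod, mem_singleton_iff, mem_Ioo] at hqv
  have h1 := hR' _ hlo
  have h2 := hR' _ hhi
  rw [mem_closedBall_zero_iff, Prod.norm_def]
  refine max_le ?_ ?_
  · rw [hqv.1]; exact h1.1
  · have := abs_le.1 h1.2
    have := abs_le.1 h2.2
    rw [Real.norm_eq_abs, abs_le]
    constructor <;> linarith [hqv.2.1, hqv.2.2]

theorem mem_component_of_mem_closure {J C : Set (ℝ × ℝ)} {p q : ℝ × ℝ}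
    (hC : C ⊆ connectedComponentIn Jᶜ p) (hp : p ∉ J)
    (hq : q ∈ closure C) (hqJ : q ∉ J) : q ∈ connectedComponentIn Jᶜ p := by
  have hpre : IsPreconnected (insert q (connectedComponentIn Jᶜ p)) :=
    isPreconnected_connectedComponentIn.subset_closure (subset_insert _ _)
      (insert_subset (closure_mono hC hq) subset_closure)
  exact hpre.subset_connectedComponentIn (Or.inr (mem_connectedComponentIn hp))
    (insert_subset hqJ (connectedComponentIn_subset _ _)) (Or.inl rfl)

theorem openSeg_subset_component {J : Set (ℝ × ℝ)} {p q : ℝ × ℝ}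
    (hq : q ∈ connectedComponentIn Jᶜ p) : openSeg J q ⊆ connectedComponentIn Jᶜ p := by
  rw [connectedComponentIn_eq hq]
  exact fun r hr => mem_component_of_mem_openSeg hr

theorem sweep_subset_component {J : Set (ℝ × ℝ)} (hJ : IsClosed J) {p a : ℝ × ℝ} (hp : p ∉ J)
    {t : HSeg} (ht : Disjoint t.int J) (hat : a ∈ t.carrier)
    (ha : a ∈ connectedComponentIn Jᶜ p) : sweep J t ⊆ connectedComponentIn Jᶜ p := by
  -- The point `a` may be an endpoint, while only the interior of `t` is known to avoid J; openness
  -- of the component supplies a nearby interior point.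
  obtain ⟨b, hbU, hbt⟩ := mem_closure_iff.1 (t.carrier_subset_closure_int hat) _
    (hJ.isOpen_compl.connectedComponentIn) ha
  have hint : t.int ⊆ connectedComponentIn Jᶜ p := by
    rw [connectedComponentIn_eq hbU]
    exact t.isPreconnected_int.subset_connectedComponentIn hbt (disjoint_left.1 ht)
  refine iUnion₂_subset fun z hz => openSeg_subset_component ?_
  exact mem_component_of_mem_closure hint hp (t.carrier_subset_closure_int hz.1) hz.2

theorem IsSweepline.swept_subset {J : Set (ℝ × ℝ)} (hJ : IsClosed J) {p : ℝ × ℝ} (hp : p ∉ J)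
    {t : ℕ → HSeg} {N : ℕ∞} (h : IsSweepline J p t N) :
    swept J t N ⊆ connectedComponentIn Jᶜ p := by
  have key : ∀ i : ℕ, (i : ℕ∞) < N → sweep J (t i) ⊆ connectedComponentIn Jᶜ p := by
    intro i
    induction i using Nat.strong_induction_on with
    | _ i ih =>
      intro hi
      rcases i with _ | i
      · exact sweep_subset_component hJ hp (h.disj 0 hi) ((t 0).int_subset_carrier h.start)
          (mem_connectedComponentIn hp)
      · obtain ⟨v, hv, m, hm, hend, -⟩ := h.step i hi
        have hprev : swept J t (i + 1 : ℕ) ⊆ connectedComponentIn Jᶜ p := by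
          refine iUnion₂_subset fun k hk => ?_
          have hk' : k < i + 1 := by exact_mod_cast hk
          exact ih k hk' (lt_trans hk hi)
        -- The contact point `m` is off J and in the closure of the region swept so far, hence in
        -- the same component.
        refine sweep_subset_component hJ hp (h.disj _ hi) (a := m) ?_
          (mem_component_of_mem_closure hprev hp (frontier_subset_closure (hv.1 hm))
            (disjoint_left.1 hv.2.1 hm))
        rcases hend with rfl | rfl
        · exact ⟨⟨le_rfl, (t (i + 1)).lt.le⟩, rfl⟩
        · exact ⟨⟨(t (i + 1)).lt.le, le_rfl⟩, rfl⟩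
  exact iUnion₂_subset key

theorem IsSweepline.mem_swept {J : Set (ℝ × ℝ)} {p : ℝ × ℝ} (hp : p ∉ J)
    {t : ℕ → HSeg} {N : ℕ∞} (h : IsSweepline J p t N) : p ∈ swept J t N :=
  sweep_subset_swept (i := 0) (by exact_mod_cast h.pos)
    (openSeg_subset_sweep ((t 0).int_subset_carrier h.start) (mem_openSeg_self hp))

/-- A point of the boundary of a saturated set in a bounded component of `Jᶜ` lies on a vertical
segment of that boundary. -/
theorem exists_verticalSegment_of_mem_frontier {J E : Set (ℝ × ℝ)} (hJ : IsClosed J)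
    (hE : Saturated J E) {p q : ℝ × ℝ} (hp : p ∉ J)
    (hb : Bornology.IsBounded (connectedComponentIn Jᶜ p)) (hEU : E ⊆ connectedComponentIn Jᶜ p)
    (hq : q ∈ frontier E) (hqJ : q ∉ J) :
    ∃ v ∈ verticalSegments J (frontier E), v.carrier = openSeg J q := by
  have hqU := mem_component_of_mem_closure hEU hp (frontier_subset_closure hq) hqJ
  obtain ⟨v, hv, hlo, hhi⟩ :=
    exists_vseg_carrier_eq hJ hqJ (hb.subset (openSeg_subset_component hqU))
  refine ⟨v, ⟨hv ▸ hE.frontier hJ q hq, disjoint_left.2 fun z hz => ?_, hlo, hhi⟩, hv⟩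
  rw [hv] at hz
  exact notMem_of_mem_openSeg hz

/-! ### Infinite greedy runs -/

/-- If vertical segments of a fixed length off a Jordan curve `J` have converging midpoints, then
`J` does not pass between the middle parts of some two of them. -/
theorem IsJordanCurve.exists_gap {J : Set (ℝ × ℝ)} (hJ : IsJordanCurve J) {w : ℕ → ℝ × ℝ}
    {a : ℝ × ℝ} (hw : Tendsto w atTop (𝓝 a)) {c : ℝ} (hc : 0 < c)
    (hcol : ∀ k y, |y - (w k).2| < c → ((w k).1, y) ∉ J) :
    ∃ k l, k < l ∧ |(w l).2 - (w k).2| < c / 2 ∧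
      ∀ z ∈ J, z.1 ∈ uIcc (w k).1 (w l).1 → ¬ |z.2 - (w k).2| < c / 2 := by
  obtain ⟨γ, hγ, -, rfl⟩ := hJ
  by_contra! hcon
  obtain ⟨K, hK⟩ := Metric.tendsto_atTop.1 hw (c / 4) (by linarith)
  have hclose : ∀ k ≥ K, ∀ l ≥ K, |(w l).2 - (w k).2| < c / 2 := by
    intro k hk l hl
    have h1 := (le_max_right (dist _ _) (dist _ _)).trans_lt (Prod.dist_eq (α := ℝ) (β := ℝ) ▸ hK k hk)
    have h2 := (le_max_right (dist _ _) (dist _ _)).trans_lt (Prod.dist_eq (α := ℝ) (β := ℝ) ▸ hK l hl)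
    rw [Real.dist_eq, abs_lt] at h1 h2
    rw [abs_lt]
    constructor <;> linarith [h1.1, h1.2, h2.1, h2.2]
  -- Along a subsequence the columns are ordered by abscissa, so points of J taken between
  -- consecutive columns are separated by the columns.
  obtain ⟨g, hg⟩ := exists_increasing_or_nonincreasing_subseq (α := ℝ) (· ≤ ·)
    fun k => (w (k + K)).1
  have hz : ∀ n : ℕ, ∃ θ ∈ Icc (-Real.pi) Real.pi,
      (γ (Circle.exp θ)).1 ∈ uIcc (w (g n + K)).1 (w (g (n + 1) + K)).1 ∧
      |(γ (Circle.exp θ)).2 - (w (g n + K)).2| < c / 2 := by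
    intro n
    obtain ⟨_, ⟨b, rfl⟩, h1, h2⟩ := hcon (g n + K) (g (n + 1) + K)
      (by simp)
      (hclose _ (Nat.le_add_left _ _) _ (Nat.le_add_left _ _))
    refine ⟨Complex.arg b, ⟨(Complex.neg_pi_lt_arg b).le, Complex.arg_le_pi b⟩, ?_⟩
    rw [Circle.exp_arg]
    exact ⟨h1, h2⟩
  choose θ hθI hθx hθy using hz
  obtain ⟨τ, -, φ, hφ, hτ⟩ := isCompact_Icc.tendsto_subseq hθI
  have hG : Continuous fun s : ℝ => γ (Circle.exp s) := by fun_prop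
  obtain ⟨δ, hδ, hball⟩ := Metric.continuousAt_iff.1 (hG.continuousAt (x := τ)) (c / 4)
    (by linarith)
  obtain ⟨M, hM⟩ := Metric.tendsto_atTop.1 hτ δ hδ
  have hlt : φ M < φ (M + 1) := hφ (Nat.lt_succ_self M)
  set k := φ M
  set l := φ (M + 1)
  have hmid : (w (g l + K)).1 ∈ uIcc (γ (Circle.exp (θ k))).1 (γ (Circle.exp (θ l))).1 := by
    have hk := hθx k
    have hl := hθx l
    rcases hg with hg | hg
    · have hmono : Monotone fun n => (w (g n + K)).1 :=
        monotone_nat_of_le_succ fun n => hg _ _ (Nat.lt_succ_self n)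
      rw [uIcc_of_le (hmono (Nat.le_succ _))] at hk hl
      exact mem_uIcc.2 (Or.inl ⟨hk.2.trans (hmono hlt), hl.1⟩)
    · have hmono : Antitone fun n => (w (g n + K)).1 :=
        antitone_nat_of_succ_le fun n => (not_le.1 (hg _ _ (Nat.lt_succ_self n))).le
      rw [uIcc_of_ge (hmono (Nat.le_succ _))] at hk hl
      exact mem_uIcc.2 (Or.inr ⟨hl.2, (hmono hlt).trans hk.1⟩)
  -- Nearby parameters give points of J on either side of column `l`, so the short arc between them
  -- crosses its abscissa, at a height within c/4 + c/4 + c/2 = c of the midpoint: a forbidden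
  -- place.
  obtain ⟨s, hs, hsx⟩ := intermediate_value_uIcc
    (f := fun s : ℝ => (γ (Circle.exp s)).1) (by fun_prop) hmid
  have hsub : uIcc (θ k) (θ l) ⊆ Metric.ball τ δ := by
    rw [Real.ball_eq_Ioo]
    refine ordConnected_Ioo.uIcc_subset ?_ ?_ <;> rw [← Real.ball_eq_Ioo]
    · exact hM M le_rfl
    · exact hM (M + 1) (Nat.le_succ M)
  have h1 := (le_max_right (dist _ _) (dist _ _)).trans_lt (Prod.dist_eq (α := ℝ) (β := ℝ) ▸ hball (hsub hs))
  have h2 := (le_max_right (dist _ _) (dist _ _)).trans_lt (Prod.dist_eq (α := ℝ) (β := ℝ) ▸ hball (hsub right_mem_uIcc))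
  have h3 := hθy l
  refine hcol (g l + K) (γ (Circle.exp s)).2 ?_ ⟨Circle.exp s, Prod.ext hsx rfl⟩
  simp only [Real.dist_eq, abs_lt] at h1 h2 h3 ⊢
  constructor <;> linarith [h1.1, h1.2, h2.1, h2.2, h3.1, h3.2]

/-- `t` starts at `m` and runs to a point of `J`, to the right if `σ = 1` and to the left if
`σ = -1`. -/
def RunsFrom (J : Set (ℝ × ℝ)) (t : HSeg) (m : ℝ × ℝ) (σ : ℝ) : Prop :=
  (σ = 1 ∧ t.left = m ∧ t.right ∈ J) ∨ (σ = -1 ∧ t.right = m ∧ t.left ∈ J)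

theorem RunsFrom.mem_carrier {J : Set (ℝ × ℝ)} {t : HSeg} {m : ℝ × ℝ} {σ : ℝ}
    (h : RunsFrom J t m σ) : m ∈ t.carrier := by
  rcases h with ⟨-, rfl, -⟩ | ⟨-, rfl, -⟩
  · exact ⟨⟨le_rfl, t.lt.le⟩, rfl⟩
  · exact ⟨⟨t.lt.le, le_rfl⟩, rfl⟩

/-- The far end of t is on J, so t cannot stop within a stretch free of J. -/
theorem RunsFrom.mem_int {J : Set (ℝ × ℝ)} {t : HSeg} {m : ℝ × ℝ} {σ x : ℝ}
    (h : RunsFrom J t m σ) (hx : 0 < σ * (x - m.1)) (hJ : ∀ z ∈ uIcc m.1 x, (z, m.2) ∉ J) :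
    (x, m.2) ∈ t.int := by
  rcases h with ⟨rfl, rfl, hend⟩ | ⟨rfl, rfl, hend⟩
  · have hx' : t.l < x := by simpa [HSeg.left] using hx
    refine ⟨⟨hx', ?_⟩, rfl⟩
    by_contra hle
    exact hJ t.r (mem_uIcc.2 (Or.inl ⟨t.lt.le, not_lt.1 hle⟩)) hend
  · have hx' : x < t.r := by simpa [HSeg.right] using hx
    refine ⟨⟨?_, hx'⟩, rfl⟩
    by_contra hle
    exact hJ t.l (mem_uIcc.2 (Or.inr ⟨not_lt.1 hle, t.lt.le⟩)) hend

/-- Near a point off `J`, horizontal segments from that point do not meet `J`. -/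
theorem eventually_horizontal_notMem {J : Set (ℝ × ℝ)} (hJ : IsClosed J) {m : ℝ × ℝ} (hm : m ∉ J) :
    ∀ᶠ x in 𝓝 m.1, ∀ z ∈ uIcc m.1 x, (z, m.2) ∉ J := by
  have hc : Continuous fun z : ℝ => (z, m.2) := by fun_prop
  obtain ⟨δ, hδ, h⟩ := Metric.isOpen_iff.1 (hJ.isOpen_compl.preimage hc) m.1 hm
  filter_upwards [Metric.ball_mem_nhds m.1 hδ] with x hx z hz
  exact h ((convex_ball m.1 δ).ordConnected.uIcc_subset (Metric.mem_ball_self hδ) hx hz)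

theorem VSeg.midpoint_mem_carrier (v : VSeg) : v.midpoint ∈ v.carrier := by
  have := v.lt
  refine ⟨rfl, ?_, ?_⟩ <;> dsimp only [VSeg.midpoint] <;> linarith

theorem VSeg.mem_carrier_of_abs_sub_lt {v : VSeg} {c y : ℝ} (hc : 2 * c ≤ v.length)
    (hy : |y - v.midpoint.2| < c) : (v.midpoint.1, y) ∈ v.carrier := by
  simp only [VSeg.length, VSeg.midpoint, abs_lt] at hc hy
  refine ⟨rfl, ?_, ?_⟩ <;> dsimp only <;> linarith [hy.1, hy.2]

/-- Two segments of a greedy run that start in the same direction at nearby long segments must be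
separated by `J`. -/
theorem IsGreedyRun.not_gap {J : Set (ℝ × ℝ)} (hJ : IsClosed J) {p : ℝ × ℝ} {t : ℕ → HSeg}
    {u : ℕ → VSeg} (h : IsGreedyRun J p t u ⊤)
    (hb : ∀ n : ℕ, Bornology.IsBounded (swept J t n)) {i j : ℕ} (hij : i < j) {σ c : ℝ}
    (hi : RunsFrom J (t (i + 1)) (u i).midpoint σ) (hj : RunsFrom J (t (j + 1)) (u j).midpoint σ)
    (hci : 2 * c ≤ (u i).length) (hcj : 2 * c ≤ (u j).length)
    (hy : |(u j).midpoint.2 - (u i).midpoint.2| < c / 2)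
    (hbox : ∀ z ∈ J, z.1 ∈ uIcc (u i).midpoint.1 (u j).midpoint.1 →
      ¬ |z.2 - (u i).midpoint.2| < c / 2) : False := by
  have hc : 0 < c := by linarith [abs_nonneg ((u j).midpoint.2 - (u i).midpoint.2)]
  have hui := h.mem i (ENat.natCast_lt_top _)
  have huj := h.mem j (ENat.natCast_lt_top _)
  have hmi := (u i).midpoint_mem_carrier
  have hmj := (u j).midpoint_mem_carrier
  have hsegi := openSeg_eq_carrier hui.2.1 hui.2.2.1 hui.2.2.2 hmi
  have hsub : sweep J (t (i + 1)) ⊆ swept J t (j + 1 : ℕ) :=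
    sweep_subset_swept (by exact_mod_cast Nat.succ_lt_succ hij)
  have hout : ∀ x, 0 < σ * (x - (u j).midpoint.1) → (x, (u j).midpoint.2) ∈ (t (j + 1)).int →
      (x, (u j).midpoint.2) ∉ swept J t (j + 1 : ℕ) := by
    intro x hx hxt hxs
    refine disjoint_left.1 (disjoint_exterior_frontier (hb (j + 1))) hxs
      (h.outside j (ENat.natCast_lt_top _) ⟨(t (j + 1)).int_subset_carrier hxt, fun hx' => ?_⟩)
    rw [← congrArg Prod.fst (mem_singleton_iff.1 hx')] at hx
    simp at hx
  have hσ : σ ≠ 0 := by rcases hi with ⟨rfl, -⟩ | ⟨rfl, -⟩ <;> norm_num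
  have hij' : ((u i).midpoint.1, (u j).midpoint.2) ∈ openSeg J (u i).midpoint :=
    hsegi ▸ VSeg.mem_carrier_of_abs_sub_lt hci (by linarith)
  rcases lt_trichotomy 0 (σ * ((u j).midpoint.1 - (u i).midpoint.1)) with hlt | heq | hgt
  -- Segment j lies ahead of segment i: the earlier sweep passes through it, so it meets the
  -- interior of the swept region instead of its boundary.
  · have hint := hi.mem_int hlt fun z hz hzJ => hbox _ hzJ hz (by simpa using hc)
    have hmem : ((u j).midpoint.1, (u i).midpoint.2) ∈ (u j).carrier :=
      VSeg.mem_carrier_of_abs_sub_lt hcj (by rw [abs_sub_comm]; linarith)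
    have hmem' := openSeg_subset_interior_sweep hJ hint
      (mem_openSeg_self (disjoint_left.1 huj.2.1 hmem))
    exact (huj.1 hmem).2 (interior_mono hsub hmem')
  -- Same abscissa: a small step ε in the common direction puts a point of the later segment in the
  -- earlier sweep.
  · have hx : (u j).midpoint.1 = (u i).midpoint.1 := by
      rcases mul_eq_zero.1 heq.symm with h0 | h0
      · exact absurd h0 hσ
      · linarith
    have hline : Tendsto (fun ε : ℝ => (u i).midpoint.1 + σ * ε) (𝓝[>] 0)
        (𝓝 (u i).midpoint.1) := by
      have : Continuous fun ε : ℝ => (u i).midpoint.1 + σ * ε := by fun_prop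
      simpa using (this.tendsto 0).mono_left nhdsWithin_le_nhds
    have hvec : Tendsto (fun ε : ℝ => (σ * ε, (0 : ℝ))) (𝓝[>] 0) (𝓝 0) := by
      have : Continuous fun ε : ℝ => (σ * ε, (0 : ℝ)) := by fun_prop
      simpa [Prod.zero_eq_mk] using (this.tendsto 0).mono_left nhdsWithin_le_nhds
    obtain ⟨ε, h1, h2, h3, hε⟩ := ((hline.eventually (eventually_horizontal_notMem hJ
      (disjoint_left.1 hui.2.1 hmi))).and ((hline.eventually (hx ▸ eventually_horizontal_notMem hJ
      (disjoint_left.1 huj.2.1 hmj))).and ((hvec.eventually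
        (eventually_add_mem_openSeg hJ hij')).and self_mem_nhdsWithin))).exists
    have hpos : 0 < σ * ((u i).midpoint.1 + σ * ε - (u i).midpoint.1) := by
      have : 0 < σ ^ 2 * ε := mul_pos (by positivity) hε
      linarith
    have hinti := hi.mem_int hpos h1
    have hintj := hj.mem_int (hx ▸ hpos) (hx ▸ h2)
    refine hout _ (hx ▸ hpos) hintj
      (hsub (openSeg_subset_sweep ((t (i + 1)).int_subset_carrier hinti) ?_))
    simpa [Prod.add_def, hx] using h3
  -- Segment j lies behind: its horizontal run reaches segment i, which was already swept.
  · have hpos : 0 < σ * ((u i).midpoint.1 - (u j).midpoint.1) := by linarith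
    have hint := hj.mem_int hpos fun z hz hzJ =>
      hbox _ hzJ (by rwa [uIcc_comm] at hz) hy
    exact hout _ hpos hint (hsub (openSeg_subset_sweep hi.mem_carrier hij'))

/-- One of the two directions occurs infinitely often; `not_gap` compares only runs in a common
direction. -/
theorem IsGreedyRun.exists_runsFrom {J : Set (ℝ × ℝ)} {p : ℝ × ℝ} {t : ℕ → HSeg}
    {u : ℕ → VSeg} (h : IsGreedyRun J p t u ⊤) :
    ∃ σ : ℝ, ∃ φ : ℕ → ℕ, StrictMono φ ∧ ∀ n, RunsFrom J (t (φ n + 1)) (u (φ n)).midpoint σ := by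
  have hor : ∃ᶠ i in atTop, RunsFrom J (t (i + 1)) (u i).midpoint 1 ∨
      RunsFrom J (t (i + 1)) (u i).midpoint (-1) := by
    refine Frequently.of_forall fun i => ?_
    rcases h.endpoints i (ENat.natCast_lt_top _) with h' | h'
    · exact Or.inl (Or.inl ⟨rfl, h'⟩)
    · exact Or.inr (Or.inr ⟨rfl, h'⟩)
  rcases frequently_or_distrib.1 hor with h' | h'
  · exact ⟨1, extraction_of_frequently_atTop h'⟩
  · exact ⟨-1, extraction_of_frequently_atTop h'⟩

/-- In an infinite greedy run the segments `u i` become arbitrarily short. -/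
theorem IsGreedyRun.exists_length_lt {J : Set (ℝ × ℝ)} (hJ : IsJordanCurve J) {p : ℝ × ℝ}
    {t : ℕ → HSeg} {u : ℕ → VSeg} (h : IsGreedyRun J p t u ⊤)
    (hb : Bornology.IsBounded (swept J t ⊤)) {c : ℝ} (hc : 0 < c) (i₀ : ℕ) :
    ∃ i ≥ i₀, (u i).length < 2 * c := by
  by_contra! hlong
  have hbn : ∀ n : ℕ, swept J t n ⊆ swept J t ⊤ := fun n =>
    iUnion₂_subset fun i hi => sweep_subset_swept (hi.trans_le le_top)
  obtain ⟨σ, φ, hφ, hruns⟩ := h.exists_runsFrom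
  have hbd : ∀ n, (u (φ (n + i₀))).midpoint ∈ closure (swept J t ⊤) := fun n =>
    closure_mono (hbn _) (frontier_subset_closure ((h.mem (φ (n + i₀)) (ENat.natCast_lt_top _)).1
      (VSeg.midpoint_mem_carrier _)))
  obtain ⟨a, -, ψ, hψ, ha⟩ := tendsto_subseq_of_bounded hb.closure hbd
  -- The shift by `i₀` keeps all indices in the range where the segments are assumed long.
  have hge : ∀ n, i₀ ≤ φ (n + i₀) := fun n => (Nat.le_add_left _ _).trans (hφ.le_apply)
  obtain ⟨k, l, hkl, hy, hbox⟩ := hJ.exists_gap ha hc fun k y hy =>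
    disjoint_left.1 (h.mem _ (ENat.natCast_lt_top _)).2.1
      (VSeg.mem_carrier_of_abs_sub_lt (hlong _ (hge (ψ k))) hy)
  exact h.not_gap hJ.isCompact.isClosed (fun n => hb.subset (hbn n))
    (hφ (Nat.add_lt_add_right (hψ hkl) i₀)) (hruns _) (hruns _) (hlong _ (hge _))
    (hlong _ (hge _)) hy hbox

theorem IsGreedyRun.isSweepline {J : Set (ℝ × ℝ)} {p : ℝ × ℝ} {t : ℕ → HSeg} {u : ℕ → VSeg}
    {N : ℕ∞} (h : IsGreedyRun J p t u N) : IsSweepline J p t N where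
  pos := h.pos
  start := h.start
  disj := h.disj
  step i hi :=
    ⟨u i, h.mem i hi, (u i).midpoint, (u i).midpoint_mem_carrier,
      (h.endpoints i hi).imp And.left And.left, h.outside i hi⟩

theorem IsGreedyRun.frontier_subset {J : Set (ℝ × ℝ)} (hJ : IsJordanCurve J) {p : ℝ × ℝ}
    (hp : p ∉ J) (hb : Bornology.IsBounded (connectedComponentIn Jᶜ p)) {t : ℕ → HSeg}
    {u : ℕ → VSeg} {N : ℕ∞} (h : IsGreedyRun J p t u N) : frontier (swept J t N) ⊆ J := by
  have hJc := hJ.isCompact.isClosed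
  have hsub := h.isSweepline.swept_subset hJc hp
  intro q hq
  by_contra hqJ
  induction N using ENat.recTopCoe with
  | coe n =>
    obtain ⟨v, hv, -⟩ :=
      exists_verticalSegment_of_mem_frontier hJc (saturated_swept J t n) hp hb hsub hq hqJ
    exact (h.halt n rfl ▸ hv : v ∈ (∅ : Set VSeg))
  | top =>
    obtain ⟨c, hc, hball⟩ := exists_ball_disjoint hJc hqJ
    obtain ⟨z, hzb, hz⟩ := mem_closure_iff.1 (frontier_subset_closure hq) _ Metric.isOpen_ball
      (Metric.mem_ball_self hc)
    obtain ⟨i₀, -, hz⟩ := mem_iUnion₂.1 hz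
    obtain ⟨i, hi, hlt⟩ := h.exists_length_lt hJ (hb.subset hsub) hc i₀
    refine hlt.not_ge ?_
    have hEi : swept J t (i + 1 : ℕ) ⊆ swept J t ⊤ :=
      iUnion₂_subset fun i hi => sweep_subset_swept (hi.trans_le le_top)
    -- The ball already meets the region swept by stage i. If it missed that region's boundary, it
    -- would lie inside the region, and q would be interior.
    obtain ⟨w, hwb, hw⟩ : (Metric.ball q c ∩ frontier (swept J t (i + 1 : ℕ))).Nonempty := by
      by_contra hne
      refine hq.2 (interior_mono hEi (subset_interior_of_disjoint_frontier
        (convex_ball q c).isPreconnected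
        (disjoint_iff_inter_eq_empty.2 (not_nonempty_iff_eq_empty.1 hne))
        ⟨z, hzb, sweep_subset_swept ?_ hz⟩ (Metric.mem_ball_self hc)))
      exact_mod_cast Nat.lt_succ_of_le hi
    obtain ⟨v, hv, hvc⟩ := exists_verticalSegment_of_mem_frontier hJc (saturated_swept J t _) hp hb
      (hEi.trans hsub) hw (disjoint_left.1 hball hwb)
    refine le_trans ?_ (h.longest i (ENat.natCast_lt_top _) v hv)
    -- The ball is a square of side 2c off J, so the vertical segment through `w` crosses its full
    -- height.
    have hin : Ioo (q.2 - c) (q.2 + c) ⊆ Ioo v.lo v.hi := by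
      intro y hy
      have hyb : (w.1, y) ∈ Metric.ball q c := by
        rw [Metric.mem_ball, Prod.dist_eq] at hwb ⊢
        refine max_lt (lt_of_le_of_lt (le_max_left _ _) hwb) ?_
        rwa [← Metric.mem_ball, Real.ball_eq_Ioo]
      have : (w.1, y) ∈ v.carrier :=
        hvc ▸ mem_openSeg_of_segment_subset (convex_ball q c) hball hwb hyb rfl
      exact this.2
    have := (Ioo_subset_Ioo_iff (by linarith)).1 hin
    simp only [VSeg.length]
    linarith [this.1, this.2]

end Sweepline

/-! ### The greedy region is the whole component, bounded by J -/

theorem mainTheorem1 (J : Set (ℝ × ℝ)) (hJ : Sweepline.IsJordanCurve J)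
    (p : ℝ × ℝ) (hp : p ∉ J)
    (hfin : ∀ s, Sweepline.SegEquiv J (Sweepline.openSeg J p) s → Bornology.IsBounded s)
    (t : ℕ → Sweepline.HSeg) (u : ℕ → Sweepline.VSeg) (N : ℕ∞)
    (hrun : Sweepline.IsGreedyRun J p t u N) :
    Sweepline.IsMaximalSweepline J p t N := by
  have hJc := hJ.isCompact.isClosed
  have hb := Sweepline.isBounded_component hJ.isCompact hp hfin
  have hs := hrun.isSweepline
  have hsub := hs.swept_subset hJc hp
  have hfr := hrun.frontier_subset hJ hp hb
  have hE : Sweepline.swept J t N = connectedComponentIn Jᶜ p := by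
    refine hsub.antisymm ((Sweepline.subset_interior_of_disjoint_frontier
      isPreconnected_connectedComponentIn ?_ ⟨p, mem_connectedComponentIn hp, hs.mem_swept hp⟩).trans
      interior_subset)
    exact Set.disjoint_left.2 fun z hz hz' => connectedComponentIn_subset _ _ hz (hfr hz')
  have hK : Sweepline.boundary J t N = J :=
    hfr.antisymm (hJ.subset_frontier
      (Set.disjoint_left.2 fun z hz => connectedComponentIn_subset _ _ (hsub hz))
      (hb.subset hsub) ⟨p, hs.mem_swept hp⟩ hfr)
  refine ⟨hs, ⟨⟨t, N, hs, rfl⟩, ?_⟩, ?_, ?_⟩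
  · rintro _ ⟨t', N', hs', rfl⟩ -
    exact hE ▸ hs'.swept_subset hJc hp
  · rw [hK]
    exact ⟨hJ, Set.subset_union_left⟩
  -- The boundary is J itself, while a vertical segment would have to lie in it and avoid J.
  · rw [hK, Set.eq_empty_iff_forall_notMem]
    rintro v ⟨hvJ, hd, -⟩
    obtain ⟨y, hy⟩ := Set.nonempty_Ioo.2 v.lt
    have hmem : (v.x, y) ∈ v.carrier := ⟨rfl, hy⟩
    exact Set.disjoint_left.1 hd hmem (hvJ hmem)
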